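/- Let $d$ be a positive integer. A $(s,d)$-cube is a closed solid cube of side length $s>0$ in $\mathbb{R}^d$, in any position and orientation. A matching of a finite set $P\subset\mathbb{R}^d$ of even size is a partition $M$ of $P$ into unordered pairs of distinct points; it is min-cost if it minimizes $\sum_{\{p,q\}\in M}\|p-q\|$ (Euclidean norm) among all matchings of $P$. For a $(w,d)$-cube $C_w$ and a pair $\{p,q\}$ whose segment $\overline{pq}$ meets $C_w$, let $p_B$ (resp. $q_B$) be the point of $\overline{pq}\cap C_w$ closest to $p$ (resp. to $q$), and define the truncated length $$\rho(C_w,M)=\sum_{\{p,q\}\in M,\ \overline{pq}\cap C_w\neq\emptyset}\min\left\{(2w)^d,\ \|p_B-q_B\|^d\right\}.$$ Then there is a constant $c>0$ depending only on $d$ such that, for all $\ell,w>0$, every $(\ell,d)$-cube $C_\ell$, every $(w,d)$-cube $C_w\subset C_\ell$, every finite set $P\subset C_\ell$ of even size, and every min-cost matching $M$ of $P$, $$\rho(C_w,M)\le c\,w^d .$$ -/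

import Mathlib

namespace MinCostMatching

/-- The space `ℝ^d` with the Euclidean norm. -/
abbrev Pt (d : ℕ) : Type := EuclideanSpace ℝ (Fin d)

/-- `C` is a closed solid `d`-dimensional cube of side length `s` in `ℝ^d`, in arbitrary position
and orientation: the image of `[0, s]^d` under an isometry of `ℝ^d`. -/
def IsCube {d : ℕ} (s : ℝ) (C : Set (Pt d)) : Prop :=
  ∃ φ : Pt d ≃ᵢ Pt d, C = φ '' {x | ∀ i, x i ∈ Set.Icc 0 s}

/-- `M` is a (perfect) matching of the finite point set `P`: a decomposition of `P` into
unordered pairs of distinct points of `P`, each point of `P` being in exactly one pair. -/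
def IsMatching {d : ℕ} (P : Finset (Pt d)) (M : Finset (Sym2 (Pt d))) : Prop :=
  (∀ e ∈ M, ¬ e.IsDiag ∧ ∀ x ∈ e, x ∈ P) ∧ ∀ p ∈ P, ∃! e, e ∈ M ∧ p ∈ e

/-- The Euclidean length `‖p - q‖` of the edge `{p, q}`. -/
noncomputable def edgeLength {d : ℕ} (e : Sym2 (Pt d)) : ℝ :=
  Sym2.lift ⟨fun p q => ‖p - q‖, fun p q => norm_sub_rev p q⟩ e

/-- The cost of a matching: the sum of the (first powers of the) lengths of its edges. -/
noncomputable def cost {d : ℕ} (M : Finset (Sym2 (Pt d))) : ℝ :=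
  ∑ e ∈ M, edgeLength e

/-- `M` is a minimum-cost matching of `P`. -/
def IsMinCostMatching {d : ℕ} (P : Finset (Pt d)) (M : Finset (Sym2 (Pt d))) : Prop :=
  IsMatching P M ∧ ∀ M' : Finset (Sym2 (Pt d)), IsMatching P M' → cost M ≤ cost M'

/-- `b` is a point of the segment from `p` to `q` inside `O` that is closest to `p`. -/
def IsNearPoint {d : ℕ} (O : Set (Pt d)) (p q b : Pt d) : Prop :=
  b ∈ segment ℝ p q ∩ O ∧ ∀ x ∈ segment ℝ p q ∩ O, ‖p - b‖ ≤ ‖p - x‖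

/-- If `O` is closed and meets the segment, there is a point as in `IsNearPoint`. -/
theorem IsNearPoint.exists_of_isClosed {d : ℕ} {O : Set (Pt d)} (hO : IsClosed O) {p q : Pt d}
    (h : (segment ℝ p q ∩ O).Nonempty) : ∃ b, IsNearPoint O p q b := by
  have hc : IsCompact (segment ℝ p q) := by
    rw [segment_eq_image ℝ p q]
    exact isCompact_Icc.image (by fun_prop)
  obtain ⟨b, hb, hmin⟩ := (hc.inter_right hO).exists_isMinOn h
    (f := fun x => ‖p - x‖) (by fun_prop)
  exact ⟨b, hb, fun x hx => hmin hx⟩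

/-- There is at most one point as in `IsNearPoint`. -/
theorem IsNearPoint.unique {d : ℕ} {O : Set (Pt d)} {p q b c : Pt d}
    (hb : IsNearPoint O p q b) (hc : IsNearPoint O p q c) : b = c := by
  have h : ‖p - b‖ = ‖p - c‖ := le_antisymm (hb.2 c hc.1) (hc.2 b hb.1)
  have hb1 := hb.1.1
  have hc1 := hc.1.1
  rw [segment_eq_image' ℝ p q] at hb1 hc1
  obtain ⟨s, hs, rfl⟩ := hb1
  obtain ⟨t, ht, rfl⟩ := hc1
  simp only [sub_add_cancel_left, norm_neg, norm_smul, Real.norm_eq_abs, abs_of_nonneg hs.1,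
    abs_of_nonneg ht.1] at h
  rcases mul_eq_mul_right_iff.mp h with h | h
  · rw [h]
  · rw [norm_eq_zero.mp h]; simp

open Classical in
/-- The point of the segment from `p` to `q` inside `O` closest to `p`. It is
`nearPoint O p q` for the endpoint `p` and `nearPoint O q p` for the endpoint `q`; the value is
a dummy if there is no such point, which for closed `O` happens only if `O` misses the segment. -/
noncomputable def nearPoint {d : ℕ} (O : Set (Pt d)) (p q : Pt d) : Pt d :=
  if h : ∃ b, IsNearPoint O p q b then h.choose else p

theorem nearPoint_eq {d : ℕ} {O : Set (Pt d)} {p q b : Pt d} (h : IsNearPoint O p q b) :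
    nearPoint O p q = b := by
  have hex : ∃ b, IsNearPoint O p q b := ⟨b, h⟩
  rw [nearPoint, dif_pos hex]
  exact hex.choose_spec.unique h

open Classical in
/-- The contribution of the edge `{p, q}` to the truncated length: edges whose segment misses `O`
contribute nothing, and the others contribute `min {(2w)^d, ‖p_B - q_B‖^d}`. -/
noncomputable def edgeContribution {d : ℕ} (w : ℝ) (O : Set (Pt d)) (e : Sym2 (Pt d)) : ℝ :=
  Sym2.lift
    ⟨fun p q => if (segment ℝ p q ∩ O).Nonempty then
        min ((2 * w) ^ d) (‖nearPoint O p q - nearPoint O q p‖ ^ d) else 0,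
      fun p q => by
        simp only [segment_symm ℝ p q, norm_sub_rev (nearPoint O p q) (nearPoint O q p)]⟩ e

/-- The truncated length of the matching `M` restricted to the object `O` with width
parameter `w`. -/
noncomputable def rho {d : ℕ} (w : ℝ) (O : Set (Pt d)) (M : Finset (Sym2 (Pt d))) : ℝ :=
  ∑ e ∈ M, edgeContribution w O e

end MinCostMatching

/-! Optimality of the matching gives cyclic monotonicity of its edges, in either orientation:
exchanging the edges of a cycle for the connecting pieces never shortens it
(`IsMinCostMatching.cyclicallyMonotone`). By the triangle inequality this passes to the parts of the
edges inside the cube (`CyclicallyMonotone.truncate`), so it suffices to bound the sum of `d`-th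
powers of lengths for a cyclically monotone family inside a ball of radius `√d * w`.

Around the midpoint of each segment put a ball of radius `ε` times its length. The claim is that at
most half of such a ball is covered by the balls of shorter segments
(`CyclicallyMonotone.measure_inter_le`). Then the volumes of the balls add up to at most twice the
volume of their union, which is `O(w^d)`.

For the claim, take a segment of length `L` and a line parallel to it at distance at most `2εL` from
its midpoint. Leaving the segment for this line costs only `O(ε²L)`, while every short segment
picked up on the way saves a fixed fraction of its length. By monotonicity the short segments met
have total length `O(ε²L)`, little compared with the width `2εL` of the ball
(`CyclicallyMonotone.sum_le_of_line`). Integrating over all such lines bounds the covered volume. -/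

namespace MinCostMatching

/-! ### Paths through segments and cyclic monotonicity -/

section Chain
variable {ι E : Type*} [NormedAddCommGroup E]

/-- The length of the connecting pieces of a path from `x` to `y` that runs through the segments
from `P i` to `Q i`, for `i` in the list. -/
noncomputable def chain (P Q : ι → E) : E → List ι → E → ℝ
  | x, [], y => ‖x - y‖
  | x, i :: l, y => ‖x - P i‖ + chain P Q (Q i) l y

/-- The family of segments from `p i` to `q i` cannot be shortened by replacing the segments on a
cycle with the pieces that connect them. -/
def CyclicallyMonotone (p q : ι → E) : Prop :=
  ∀ (e : ι) (P Q : ι → E), (∀ i, P i = p i ∧ Q i = q i ∨ P i = q i ∧ Q i = p i) →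
    ∀ l : List ι, l.Nodup → e ∉ l →
      ‖p e - q e‖ + (l.map fun i => ‖p i - q i‖).sum ≤ chain P Q (q e) l (p e)

theorem chain_le_chain_add (P Q P' Q' : ι → E) (l : List ι) (x x' y y' : E) :
    chain P Q x l y ≤ ‖x - x'‖ + chain P' Q' x' l y' + ‖y' - y‖ +
      (l.map fun i => ‖P i - P' i‖ + ‖Q i - Q' i‖).sum := by
  induction l generalizing x x' with
  | nil =>
    simp only [chain, List.map_nil, List.sum_nil, add_zero]
    have h1 := norm_sub_le_norm_sub_add_norm_sub x x' y
    have h2 := norm_sub_le_norm_sub_add_norm_sub x' y' y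
    linarith
  | cons i l ih =>
    simp only [chain, List.map_cons, List.sum_cons]
    have h1 := norm_sub_le_norm_sub_add_norm_sub x x' (P i)
    have h2 := norm_sub_le_norm_sub_add_norm_sub x' (P' i) (P i)
    have h3 := norm_sub_rev (P' i) (P i)
    have := ih (Q i) (Q' i)
    linarith

/-- Cyclic monotonicity is inherited by subsegments. -/
theorem CyclicallyMonotone.truncate {p q p' q' : ι → E} (h : CyclicallyMonotone p q)
    (ht : ∀ i, ‖p i - q i‖ = ‖p i - p' i‖ + ‖p' i - q' i‖ + ‖q' i - q i‖) :
    CyclicallyMonotone p' q' := by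
  classical
  intro e P' Q' hP l hl hel
  -- Each full segment is traversed in the direction of its subsegment; the end pieces cut off then
  -- enter both sides equally and cancel.
  let P : ι → E := fun i => if P' i = p' i ∧ Q' i = q' i then p i else q i
  let Q : ι → E := fun i => if P' i = p' i ∧ Q' i = q' i then q i else p i
  have h1 := h e P Q (fun i => by by_cases hi : P' i = p' i ∧ Q' i = q' i <;> simp [P, Q, hi])
    l hl hel
  have h2 := chain_le_chain_add P Q P' Q' l (q e) (q' e) (p e) (p' e)
  have h3 : (l.map fun i => ‖p i - q i‖) = l.map fun i =>
      (‖P i - P' i‖ + ‖Q i - Q' i‖) + ‖p' i - q' i‖ := by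
    refine List.map_congr_left fun i _ => ?_
    rw [ht i]
    by_cases hi : P' i = p' i ∧ Q' i = q' i
    · simp only [P, Q, hi, and_self, if_true, norm_sub_rev (q' i) (q i)]; ring
    · have := (hP i).resolve_left hi
      simp only [P, Q, if_neg hi]
      simp only [this.1, this.2, norm_sub_rev (q' i) (q i)]; ring
  rw [h3, List.sum_map_add, ht e] at h1
  have := norm_sub_rev (q e) (q' e)
  have := norm_sub_rev (p e) (p' e)
  linarith

/-- A path through segments whose endpoints are close to a line. -/
theorem chain_le_of_line {y : ℝ → E} (hy : ∀ s t, ‖y s - y t‖ = |s - t|) {P Q : ι → E}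
    {t g κ : ι → ℝ} {s₁ : ℝ} {z : E} (l : List ι)
    (hl : l.Pairwise fun i j => t i + g i ≤ t j - g j)
    (hP : ∀ i ∈ l, ‖P i - y (t i - g i)‖ ≤ κ i) (hQ : ∀ i ∈ l, ‖Q i - y (t i + g i)‖ ≤ κ i)
    (h₁ : ∀ i ∈ l, t i + g i ≤ s₁) {s₀ : ℝ} (h₀₁ : s₀ ≤ s₁) (h₀ : ∀ i ∈ l, s₀ ≤ t i - g i)
    (x : E) :
    chain P Q x l z ≤ ‖x - y s₀‖ + (s₁ - s₀) + (l.map fun i => 2 * κ i - 2 * g i).sum +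
      ‖y s₁ - z‖ := by
  induction l generalizing x s₀ with
  | nil =>
    simp only [chain, List.map_nil, List.sum_nil, add_zero]
    have h1 := norm_sub_le_norm_sub_add_norm_sub x (y s₀) z
    have h2 := norm_sub_le_norm_sub_add_norm_sub (y s₀) (y s₁) z
    rw [hy, abs_sub_comm, abs_of_nonneg (by linarith)] at h2
    linarith
  | cons i l ih =>
    simp only [List.forall_mem_cons, List.pairwise_cons] at *
    simp only [chain, List.map_cons, List.sum_cons]
    have h1 := norm_sub_le_norm_sub_add_norm_sub x (y s₀) (P i)
    have h2 := norm_sub_le_norm_sub_add_norm_sub (y s₀) (y (t i - g i)) (P i)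
    rw [hy, abs_sub_comm, abs_of_nonneg (by linarith)] at h2
    have h3 := norm_sub_rev (P i) (y (t i - g i))
    have := ih hl.2 hP.2 hQ.2 h₁.2 h₁.1 hl.1 (Q i)
    linarith

end Chain

/-! ### Exchanging edges in a matching -/

section Swap
variable {d : ℕ}

theorem IsMatching.eq_of_mem {P : Finset (Pt d)} {M : Finset (Sym2 (Pt d))} (h : IsMatching P M)
    {e f : Sym2 (Pt d)} (he : e ∈ M) (hf : f ∈ M) {x : Pt d} (hxe : x ∈ e) (hxf : x ∈ f) :
    e = f :=
  (h.2 x ((h.1 e he).2 x hxe)).unique ⟨he, hxe⟩ ⟨hf, hxf⟩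

open Classical in
theorem IsMatching.swap {P : Finset (Pt d)} {M : Finset (Sym2 (Pt d))} (h : IsMatching P M)
    {a b p q : Pt d} (hab : s(a, b) ∈ M) (hpq : s(p, q) ∈ M) (hne : s(a, b) ≠ s(p, q)) :
    IsMatching P (insert s(b, p) (insert s(q, a) ((M.erase s(a, b)).erase s(p, q)))) ∧
    cost (insert s(b, p) (insert s(q, a) ((M.erase s(a, b)).erase s(p, q)))) =
      cost M - ‖a - b‖ - ‖p - q‖ + ‖b - p‖ + ‖q - a‖ := by
  have hap : a ≠ p := by
    rintro rfl; exact hne (h.eq_of_mem hab hpq (x := a) (by simp) (by simp))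
  have haq : a ≠ q := by
    rintro rfl; exact hne (h.eq_of_mem hab hpq (x := a) (by simp) (by simp))
  have hbp : b ≠ p := by
    rintro rfl; exact hne (h.eq_of_mem hab hpq (x := b) (by simp) (by simp))
  have hbq : b ≠ q := by
    rintro rfl; exact hne (h.eq_of_mem hab hpq (x := b) (by simp) (by simp))
  have hab' : a ≠ b := by simpa using (h.1 _ hab).1
  have hpq' : p ≠ q := by simpa using (h.1 _ hpq).1
  have haP := (h.1 _ hab).2 a (by simp)
  have hbP := (h.1 _ hab).2 b (by simp)
  have hpP := (h.1 _ hpq).2 p (by simp)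
  have hqP := (h.1 _ hpq).2 q (by simp)
  have hold : ∀ {e x}, e ∈ (M.erase s(a, b)).erase s(p, q) → x ∈ e →
      x ≠ a ∧ x ≠ b ∧ x ≠ p ∧ x ≠ q := by
    intro e x he hx
    simp only [Finset.mem_erase] at he
    refine ⟨?_, ?_, ?_, ?_⟩ <;> rintro rfl
    · exact he.2.1 (h.eq_of_mem he.2.2 hab hx (by simp))
    · exact he.2.1 (h.eq_of_mem he.2.2 hab hx (by simp))
    · exact he.1 (h.eq_of_mem he.2.2 hpq hx (by simp))
    · exact he.1 (h.eq_of_mem he.2.2 hpq hx (by simp))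
  have hn1 : s(q, a) ∉ (M.erase s(a, b)).erase s(p, q) := fun hm =>
    (hold hm (x := q) (by simp)).2.2.2 rfl
  have hn2 : s(b, p) ∉ insert s(q, a) ((M.erase s(a, b)).erase s(p, q)) := by
    rw [Finset.mem_insert, not_or]
    refine ⟨fun he => ?_, fun hm => (hold hm (x := p) (by simp)).2.2.1 rfl⟩
    have : b ∈ s(q, a) := he ▸ (by simp)
    simp [hbq, hab'.symm] at this
  refine ⟨⟨?_, ?_⟩, ?_⟩
  · intro e he
    simp only [Finset.mem_insert, Finset.mem_erase] at he
    rcases he with rfl | rfl | he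
    · simp [hbp, hbP, hpP]
    · simp [haq.symm, haP, hqP]
    · exact h.1 e he.2.2
  · intro x hx
    by_cases hxab : x = b ∨ x = p
    · refine ⟨s(b, p), ⟨by simp, by simpa using hxab⟩, ?_⟩
      rintro f ⟨hf, hxf⟩
      rcases Finset.mem_insert.1 hf with rfl | hf
      · rfl
      rcases Finset.mem_insert.1 hf with rfl | hf
      · rcases hxab with rfl | rfl
        · simp [hbq, hab'.symm] at hxf
        · simp [hpq', hap.symm] at hxf
      · have := hold hf hxf; tauto
    by_cases hxqa : x = q ∨ x = a
    · refine ⟨s(q, a), ⟨by simp, by simpa using hxqa⟩, ?_⟩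
      rintro f ⟨hf, hxf⟩
      rcases Finset.mem_insert.1 hf with rfl | hf
      · exact absurd (by simpa using hxf) hxab
      rcases Finset.mem_insert.1 hf with rfl | hf
      · rfl
      · have := hold hf hxf; tauto
    obtain ⟨e, ⟨he, hxe⟩, huniq⟩ := h.2 x hx
    have hx1 : e ≠ s(a, b) := by rintro rfl; simp at hxe; tauto
    have hx2 : e ≠ s(p, q) := by rintro rfl; simp at hxe; tauto
    refine ⟨e, ⟨by simp [he, hx1, hx2], hxe⟩, ?_⟩
    rintro f ⟨hf, hxf⟩
    simp only [Finset.mem_insert, Finset.mem_erase] at hf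
    rcases hf with rfl | rfl | hf
    · exact absurd (by simpa using hxf) hxab
    · exact absurd (by simpa using hxf) hxqa
    · exact huniq f ⟨hf.2.2, hxf⟩
  · have h1 := Finset.add_sum_erase M edgeLength hab
    have h2 := Finset.add_sum_erase (M.erase s(a, b)) edgeLength
      (Finset.mem_erase.2 ⟨hne.symm, hpq⟩)
    rw [cost, Finset.sum_insert hn2, Finset.sum_insert hn1, cost]
    simp only [edgeLength, Sym2.lift_mk] at h1 h2 ⊢
    linarith

/-- A cycle exchange is a succession of two-edge swaps: the closing edge back to `a` created by one
swap is the edge opened by the next, so every intermediate stage is a matching. -/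
theorem IsMatching.exists_cost_le {ι : Type*} {P : Finset (Pt d)} {p q : ι → Pt d} (l : List ι)
    (hl : (l.map fun i => s(p i, q i)).Nodup) {M : Finset (Sym2 (Pt d))} (h : IsMatching P M)
    (hM : ∀ i ∈ l, s(p i, q i) ∈ M) {a b : Pt d} (hab : s(a, b) ∈ M)
    (hne : ∀ i ∈ l, s(a, b) ≠ s(p i, q i)) :
    ∃ M', IsMatching P M' ∧ cost M' ≤
      cost M - ‖a - b‖ - (l.map fun i => ‖p i - q i‖).sum + chain p q b l a := by
  classical
  induction l generalizing M b with
  | nil => exact ⟨M, h, by simp [chain, norm_sub_rev a b]⟩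
  | cons i l ih =>
    simp only [List.forall_mem_cons, List.map_cons, List.nodup_cons] at *
    obtain ⟨hm, hc⟩ := h.swap hab hM.1 hne.1
    obtain ⟨M', h1, h2⟩ := ih hl.2 hm (b := q i) (fun j hj => by
      have h3 : s(p j, q j) ≠ s(p i, q i) := fun he => hl.1 (List.mem_map.2 ⟨j, hj, he⟩)
      simp [h3, (hne.2 j hj).symm, hM.2 j hj]) (by simp [Sym2.eq_swap (a := a)])
      (fun j hj he => by
        refine hne.2 j hj (h.eq_of_mem hab (hM.2 j hj) (x := a) (by simp) ?_)
        rw [← he]; simp)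
    refine ⟨M', h1, h2.trans ?_⟩
    simp only [chain, List.sum_cons, hc, norm_sub_rev a (q i)]
    linarith

theorem IsMinCostMatching.cyclicallyMonotone {ι : Type*} {P : Finset (Pt d)}
    {M : Finset (Sym2 (Pt d))} (h : IsMinCostMatching P M) {p q : ι → Pt d}
    (hM : ∀ i, s(p i, q i) ∈ M) (hinj : Function.Injective fun i => s(p i, q i)) :
    CyclicallyMonotone p q := by
  intro e A B hAB l hl hel
  have hs : ∀ i, s(A i, B i) = s(p i, q i) := fun i => by
    rcases hAB i with ⟨h1, h2⟩ | ⟨h1, h2⟩ <;> rw [h1, h2]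
    exact Sym2.eq_swap
  have hn : ∀ i, ‖A i - B i‖ = ‖p i - q i‖ := fun i => by
    rcases hAB i with ⟨h1, h2⟩ | ⟨h1, h2⟩ <;> rw [h1, h2]
    exact norm_sub_rev _ _
  obtain ⟨M', h1, h2⟩ := h.1.exists_cost_le (p := A) (q := B) l
    (by simp only [hs]; exact hl.map hinj) (fun i _ => hs i ▸ hM i) (hM e)
    (fun i hi he => hel (by rw [hs] at he; exact hinj he ▸ hi))
  have := h.2 M' h1
  simp only [hn] at h2
  linarith

end Swap

/-! ### Short segments met by a line -/

section Line
open MeasureTheory Metric Set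

variable {E : Type*} [NormedAddCommGroup E] [InnerProductSpace ℝ E]

theorem exists_sorted_of_pairwiseDisjoint {ι : Type*} (s : Finset ι) (t g : ι → ℝ)
    (hg : ∀ i ∈ s, 0 ≤ g i)
    (hs : (s : Set ι).PairwiseDisjoint fun i => closedBall (t i) (g i)) :
    ∃ l : List ι, l.Nodup ∧ (∀ i, i ∈ l ↔ i ∈ s) ∧
      (∀ f : ι → ℝ, (l.map f).sum = ∑ i ∈ s, f i) ∧
      l.Pairwise fun i j => t i + g i ≤ t j - g j := by
  classical
  let r : ι → ι → Prop := fun i j => t i ≤ t j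
  have : Std.Total r := ⟨fun i j => le_total _ _⟩
  have : IsTrans ι r := ⟨fun i j k h1 h2 => le_trans h1 h2⟩
  have hperm := List.perm_insertionSort r s.toList
  have hnd : (s.toList.insertionSort r).Nodup := hperm.nodup_iff.2 s.nodup_toList
  have hmem : ∀ i, i ∈ s.toList.insertionSort r ↔ i ∈ s := fun i => by
    rw [hperm.mem_iff, Finset.mem_toList]
  refine ⟨s.toList.insertionSort r, hnd, hmem, fun f => ?_, ?_⟩
  · rw [(hperm.map f).sum_eq, Finset.sum_map_toList]
  · refine ((List.pairwise_insertionSort r s.toList).and hnd).imp_of_mem ?_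
    rintro i j hi hj ⟨hij, hne⟩
    rw [hmem] at hi hj
    have hd := hs hi hj hne
    have h1 := hg i hi
    have h2 := hg j hj
    by_contra! hlt
    have hij' : t i ≤ t j := hij
    -- If the intervals were out of order, this point would lie in both.
    refine Set.disjoint_left.1 hd (show max (t i) (t j - g j) ∈ _ from ?_) ?_ <;>
      simp only [Real.closedBall_eq_Icc, mem_Icc]
    · exact ⟨by linarith [le_max_left (t i) (t j - g j)], max_le (by linarith) (by linarith)⟩
    · exact ⟨le_max_right _ _, max_le (by linarith) (by linarith)⟩

/-- A line that is parallel to a segment of a cyclically monotone family and close to its midpoint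
comes near to the midpoints of shorter segments only on a small part of its length. -/
theorem CyclicallyMonotone.sum_le_of_line {ι : Type*} {p q : ι → E}
    (h : CyclicallyMonotone p q) (e : ι) {L : ℝ} (hL : 0 < L) (hpq : ‖p e - q e‖ = L)
    {ε : ℝ} (hε : 0 < ε) (hε' : ε ≤ 1 / 80) {x u : E} (hu : ‖u‖ = 1) (hue : p e - q e = L • u)
    {τ : ℝ} {v : E} (hx : x = midpoint ℝ (p e) (q e) + τ • u + v) (huv : inner ℝ u v = 0)
    (hv : ‖v‖ ≤ 2 * ε * L) (s : Finset ι) (hes : e ∉ s) {t : ι → ℝ}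
    (hsL : ∀ i ∈ s, ‖p i - q i‖ ≤ L)
    (ht : ∀ i ∈ s, |t i + τ| ≤ ε * L)
    (hnear : ∀ i ∈ s, ‖x + t i • u - midpoint ℝ (p i) (q i)‖ ≤ ε * ‖p i - q i‖)
    (hs : (s : Set ι).PairwiseDisjoint fun i => closedBall (t i) (‖p i - q i‖ / 8)) :
    ∑ i ∈ s, ‖p i - q i‖ ≤ 160 * ε ^ 2 * L := by
  classical
  obtain ⟨l, hnd, hmem, hsum, hpw⟩ :=
    exists_sorted_of_pairwiseDisjoint s t (fun i => ‖p i - q i‖ / 8) (fun i _ => by positivity) hs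
  -- Other segments are cut down to their middle quarters, of half-length `‖p i - q i‖ / 8`,
  -- matching the disjoint intervals on the line.
  let w : ι → E := fun i => (1 / 8 : ℝ) • (q i - p i)
  have hw : ∀ i, ‖w i‖ = ‖p i - q i‖ / 8 := fun i => by
    simp only [w, norm_smul, norm_sub_rev (q i)]; norm_num; ring
  let p' : ι → E := fun i => if i = e then p i else midpoint ℝ (p i) (q i) - w i
  let q' : ι → E := fun i => if i = e then q i else midpoint ℝ (p i) (q i) + w i
  have hm1 : ∀ i, midpoint ℝ (p i) (q i) = p i + (4 : ℝ) • w i := fun i => by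
    simp only [w, midpoint_eq_smul_add, invOf_eq_inv]; module
  have hm2 : ∀ i, midpoint ℝ (p i) (q i) = q i - (4 : ℝ) • w i := fun i => by
    simp only [w, midpoint_eq_smul_add, invOf_eq_inv]; module
  have hlen : ∀ i, i ≠ e → ‖p' i - q' i‖ = ‖p i - q i‖ / 4 := fun i hi => by
    have : p' i - q' i = (-2 : ℝ) • w i := by simp only [p', q', if_neg hi]; module
    rw [this, norm_smul, hw]; norm_num; ring
  have h' : CyclicallyMonotone p' q' := by
    refine h.truncate fun i => ?_
    by_cases hi : i = e
    · simp [p', q', hi]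
    · rw [hlen i hi]
      have h1 : p i - p' i = (-3 : ℝ) • w i := by simp only [p', if_neg hi, hm1 i]; module
      have h2 : q' i - q i = (-3 : ℝ) • w i := by simp only [q', if_neg hi, hm2 i]; module
      rw [h1, h2, norm_smul, hw]; norm_num; ring
  -- Oriented to make an angle of at most 90° with `u`, each half-quarter differs from its
  -- counterpart on the line by at most `√2 ≤ 3/2` times its length.
  let σ : ι → ℝ := fun i => if 0 ≤ inner ℝ (w i) u then 1 else -1
  have hσ : ∀ i, 0 ≤ inner ℝ (σ i • w i) u ∧ ‖σ i • w i‖ = ‖p i - q i‖ / 8 := fun i => by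
    by_cases hi : 0 ≤ inner ℝ (w i) u
    · simp [σ, hi, hw]
    · simp only [σ, hi, if_false, neg_smul, one_smul, inner_neg_left, norm_neg, hw, and_true]
      linarith
  let P : ι → E := fun i => if i = e then p i else midpoint ℝ (p i) (q i) - σ i • w i
  let Q : ι → E := fun i => if i = e then q i else midpoint ℝ (p i) (q i) + σ i • w i
  have hcm := h' e P Q (fun i => by
    by_cases hi : i = e
    · left; simp [P, Q, p', q', hi]
    by_cases hi' : 0 ≤ inner ℝ (w i) u
    · left; simp [P, Q, p', q', σ, hi, hi']
    · right; simp [P, Q, p', q', σ, hi, hi', sub_eq_add_neg]) l hnd (by rwa [hmem])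
  have hpe : p' e = p e := by simp [p']
  have hqe : q' e = q e := by simp [q']
  have hdist : ∀ i ∈ s, ‖σ i • w i - (‖p i - q i‖ / 8) • u‖ ≤ 3 / 2 * (‖p i - q i‖ / 8) := by
    intro i _
    refine abs_le_of_sq_le_sq' ?_ (by positivity) |>.2
    rw [norm_sub_sq_real, (hσ i).2, inner_smul_right, norm_smul, hu, Real.norm_eq_abs,
      abs_of_nonneg (by positivity)]
    nlinarith [mul_nonneg (by positivity : 0 ≤ ‖p i - q i‖ / 8) (hσ i).1,
      sq_nonneg (‖p i - q i‖ / 8)]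
  let y : ℝ → E := fun a => x + a • u
  have hy : ∀ a b, ‖y a - y b‖ = |a - b| := fun a b => by
    have : y a - y b = (a - b) • u := by simp only [y]; module
    rw [this, norm_smul, hu, mul_one, Real.norm_eq_abs]
  have hin : ∀ i ∈ s, -τ - L / 4 ≤ t i - ‖p i - q i‖ / 8 ∧ t i + ‖p i - q i‖ / 8 ≤ -τ + L / 4 := by
    intro i hi
    have h1 := abs_le.1 (ht i hi)
    have h2 := hsL i hi
    constructor <;> nlinarith
  have hline := chain_le_of_line hy (P := P) (Q := Q) (t := t) (g := fun i => ‖p i - q i‖ / 8)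
    (κ := fun i => ε * ‖p i - q i‖ + 3 / 2 * (‖p i - q i‖ / 8)) (s₁ := -τ + L / 4) (z := p e) l hpw
    (fun i hi => by
      rw [hmem] at hi
      have hie : i ≠ e := fun hh => hes (hh ▸ hi)
      have : P i - y (t i - ‖p i - q i‖ / 8) = -(x + t i • u - midpoint ℝ (p i) (q i)) -
        (σ i • w i - (‖p i - q i‖ / 8) • u) := by simp only [P, if_neg hie, y]; module
      rw [this]
      refine (norm_sub_le _ _).trans (add_le_add ?_ (hdist i hi))
      rw [norm_neg]; exact hnear i hi)
    (fun i hi => by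
      rw [hmem] at hi
      have hie : i ≠ e := fun hh => hes (hh ▸ hi)
      have : Q i - y (t i + ‖p i - q i‖ / 8) = -(x + t i • u - midpoint ℝ (p i) (q i)) +
        (σ i • w i - (‖p i - q i‖ / 8) • u) := by simp only [Q, if_neg hie, y]; module
      rw [this]
      refine (norm_add_le _ _).trans (add_le_add ?_ (hdist i hi))
      rw [norm_neg]; exact hnear i hi)
    (fun i hi => (hin i ((hmem i).1 hi)).2) (s₀ := -τ - L / 4) (by linarith)
    (fun i hi => (hin i ((hmem i).1 hi)).1) (q e)
  -- By Pythagoras, an offset of at most `2εL` over a run of `L/4` lengthens it by at most `(2εL)² /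
  -- (2 · L/4) = 8ε²L`.
  have hend : ∀ c : ℝ, |c| = L / 4 → ‖v + c • u‖ ≤ L / 4 + 8 * ε ^ 2 * L := by
    intro c hc
    refine abs_le_of_sq_le_sq' ?_ (by positivity) |>.2
    rw [norm_add_sq_real, inner_smul_right, real_inner_comm, huv, norm_smul, hu,
      Real.norm_eq_abs, hc]
    have : ‖v‖ ^ 2 ≤ (2 * ε * L) ^ 2 := by gcongr
    nlinarith [sq_nonneg (8 * ε ^ 2 * L)]
  have hme : ∀ a : E, a = midpoint ℝ (p e) (q e) → p e = a + (L / 2) • u ∧ q e = a - (L / 2) • u := by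
    rintro a rfl
    have hp : p e = q e + L • u := by rw [← hue]; abel
    rw [hp, midpoint_eq_smul_add, invOf_eq_inv]
    constructor <;> module
  have he1 : ‖q e - y (-τ - L / 4)‖ ≤ L / 4 + 8 * ε ^ 2 * L := by
    have : q e - y (-τ - L / 4) = -(v + (L / 4) • u) := by
      rw [(hme _ rfl).2]; simp only [y, hx]; module
    rw [this, norm_neg]
    exact hend _ (abs_of_pos (by linarith))
  have he2 : ‖y (-τ + L / 4) - p e‖ ≤ L / 4 + 8 * ε ^ 2 * L := by
    have : y (-τ + L / 4) - p e = v + (-(L / 4)) • u := by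
      rw [(hme _ rfl).1]; simp only [y, hx]; module
    rw [this]
    exact hend _ (by rw [abs_neg]; exact abs_of_pos (by linarith))
  rw [hpe, hqe, hpq, hsum] at hcm
  rw [hsum] at hline
  have hcm2 : ∑ i ∈ s, ‖p' i - q' i‖ = ∑ i ∈ s, ‖p i - q i‖ / 4 :=
    Finset.sum_congr rfl fun i hi => hlen i fun hh => hes (hh ▸ hi)
  -- The net saving per unit length is `1/4 - 1/8 - 2ε ≥ 1/10`; the two ends cost `16ε²L` together,
  -- whence `160`.
  have hfin : ∑ i ∈ s, ‖p i - q i‖ / 10 ≤ ∑ i ∈ s, (‖p i - q i‖ / 4 -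
      (2 * (ε * ‖p i - q i‖ + 3 / 2 * (‖p i - q i‖ / 8)) - 2 * (‖p i - q i‖ / 8))) :=
    Finset.sum_le_sum fun i _ => by nlinarith [norm_nonneg (p i - q i)]
  rw [Finset.sum_sub_distrib, ← Finset.sum_div] at hfin
  linarith

theorem CyclicallyMonotone.volume_line_le {ι : Type*} {p q : ι → E}
    (h : CyclicallyMonotone p q) (e : ι) {L : ℝ} (hL : 0 < L) (hpq : ‖p e - q e‖ = L)
    {ε : ℝ} (hε : 0 < ε) (hε' : ε ≤ 1 / 80) (s : Finset ι) (hes : e ∉ s)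
    (hsL : ∀ i ∈ s, ‖p i - q i‖ ≤ L) {x u : E} (hu : ‖u‖ = 1) (hue : p e - q e = L • u)
    (hx : x ∈ ball (midpoint ℝ (p e) (q e)) (2 * (ε * L))) :
    volume {t : ℝ | x + t • u ∈ ball (midpoint ℝ (p e) (q e)) (ε * L) ∩
      ⋃ i ∈ s, ball (midpoint ℝ (p i) (q i)) (ε * ‖p i - q i‖)} ≤
      ENNReal.ofReal (200 * ε ^ 2 * L) := by
  classical
  set m := midpoint ℝ (p e) (q e) with hm
  let hit : ι → ℝ → Prop := fun i t => x + t • u ∈ ball m (ε * L) ∧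
    x + t • u ∈ ball (midpoint ℝ (p i) (q i)) (ε * ‖p i - q i‖)
  let t : ι → ℝ := fun i => if hi : ∃ a, hit i a then hi.choose else 0
  have htt : ∀ i, (∃ a, hit i a) → hit i (t i) := fun i hi => by
    simp only [t, dif_pos hi]; exact hi.choose_spec
  -- One hit parameter per segment suffices: all others lie within `2ε‖p i - q i‖`, hence in the
  -- interval of radius `‖p i - q i‖ / 8`. The Vitali enlargement gives `200 = 160 · 2 · 5/8`.
  obtain ⟨S, hSsub, hSd, hScov⟩ := Vitali.exists_disjoint_subfamily_covering_enlargement_closedBall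
    {i | i ∈ s ∧ ∃ a, hit i a} t (fun i => ‖p i - q i‖ / 8) (L / 8)
    (fun i hi => by have := hsL i hi.1; linarith) 5 (by norm_num)
  have hSs : S ⊆ (s : Set ι) := fun i hi => (hSsub hi).1
  lift S to Finset ι using s.finite_toSet.subset hSs
  have hSs' : ∀ i ∈ S, i ∈ s := fun i hi => hSs hi
  have hcover : {t : ℝ | x + t • u ∈ ball m (ε * L) ∩
      ⋃ i ∈ s, ball (midpoint ℝ (p i) (q i)) (ε * ‖p i - q i‖)} ⊆
      ⋃ i ∈ S, closedBall (t i) (5 * (‖p i - q i‖ / 8)) := by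
    rintro a ⟨ha1, ha2⟩
    simp only [mem_iUnion, exists_prop] at ha2
    obtain ⟨i, his, hai⟩ := ha2
    have hex : ∃ a, hit i a := ⟨a, ha1, hai⟩
    obtain ⟨j, hj, hsub⟩ := hScov i ⟨his, hex⟩
    refine mem_biUnion hj (hsub ?_)
    have h1 := (htt i hex).2
    rw [mem_ball_iff_norm] at h1 hai
    have h2 : (a - t i) • u = (x + a • u - midpoint ℝ (p i) (q i)) -
      (x + t i • u - midpoint ℝ (p i) (q i)) := by module
    have h3 := norm_sub_le (x + a • u - midpoint ℝ (p i) (q i))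
      (x + t i • u - midpoint ℝ (p i) (q i))
    rw [← h2, norm_smul, hu, mul_one] at h3
    rw [mem_closedBall_iff_norm]
    nlinarith [norm_nonneg (p i - q i)]
  let τ : ℝ := inner ℝ u (x - m)
  have huu : inner ℝ u u = (1 : ℝ) := by rw [real_inner_self_eq_norm_sq, hu]; norm_num
  have huv : inner ℝ u (x - m - τ • u) = 0 := by
    rw [inner_sub_right, inner_smul_right, huu, mul_one, sub_self]
  have hv : ‖x - m - τ • u‖ ≤ 2 * ε * L := by
    rw [mem_ball_iff_norm] at hx
    have h1 : ‖x - m‖ ^ 2 = ‖x - m - τ • u‖ ^ 2 + ‖τ • u‖ ^ 2 := by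
      have : x - m = (x - m - τ • u) + τ • u := by abel
      conv_lhs => rw [this]
      rw [norm_add_sq_real, inner_smul_right, real_inner_comm, huv]; ring
    have h2 : ‖x - m - τ • u‖ ≤ ‖x - m‖ :=
      (abs_le_of_sq_le_sq' (by nlinarith [sq_nonneg ‖τ • u‖]) (norm_nonneg _)).2
    linarith
  have hsum := h.sum_le_of_line e hL hpq hε hε' (x := x) hu hue (τ := τ) (v := x - m - τ • u)
    (by rw [← hm]; abel) huv hv S (fun hh => hes (hSs' e hh)) (t := t)
    (fun i hi => hsL i (hSs' i hi))
    (fun i hi => by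
      have h1 := (htt i (hSsub hi).2).1
      rw [mem_ball_iff_norm] at h1
      have h2 : inner ℝ u (x + t i • u - m) = t i + τ := by
        have : x + t i • u - m = (x - m) + t i • u := by abel
        rw [this, inner_add_right, inner_smul_right, huu]; ring
      rw [← h2]
      have := abs_real_inner_le_norm u (x + t i • u - m)
      rw [hu, one_mul] at this
      linarith)
    (fun i hi => by
      have h1 := (htt i (hSsub hi).2).2
      rw [mem_ball_iff_norm] at h1
      exact h1.le) hSd
  calc _ ≤ volume (⋃ i ∈ S, closedBall (t i) (5 * (‖p i - q i‖ / 8))) := measure_mono hcover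
    _ ≤ ∑ i ∈ S, volume (closedBall (t i) (5 * (‖p i - q i‖ / 8))) :=
        measure_biUnion_finset_le _ _
    _ = ENNReal.ofReal (∑ i ∈ S, 2 * (5 * (‖p i - q i‖ / 8))) := by
        rw [ENNReal.ofReal_sum_of_nonneg fun i _ => by positivity]
        simp only [Real.volume_closedBall]
    _ ≤ _ := by
        apply ENNReal.ofReal_le_ofReal
        rw [← Finset.mul_sum, ← Finset.mul_sum, ← Finset.sum_div]
        linarith

end Line

/-! ### From lines to volumes -/

section Volume
open MeasureTheory Metric Set

variable {E : Type*} [NormedAddCommGroup E] [InnerProductSpace ℝ E] [FiniteDimensional ℝ E]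
  [MeasurableSpace E] [BorelSpace E] (μ : Measure E) [μ.IsAddHaarMeasure]

/-- A subset of a ball whose sections by parallel lines are short has small measure. -/
theorem two_mul_measure_le_of_line {S : Set E} (hS : MeasurableSet S) {m u : E} {R : ℝ}
    (hu : ‖u‖ = 1) (hSR : S ⊆ ball m R) {K : ENNReal}
    (hK : ∀ x ∈ ball m (2 * R), volume {t : ℝ | x + t • u ∈ S} ≤ K) :
    ENNReal.ofReal (2 * R) * μ S ≤ K * μ (ball m (2 * R)) := by
  have hmeas : Measurable fun z : ℝ × E => S.indicator (1 : E → ENNReal) (z.2 + z.1 • u) :=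
    (measurable_one.indicator hS).comp (by fun_prop)
  have htr : ∀ t : ℝ, ∫⁻ x, S.indicator (1 : E → ENNReal) (x + t • u) ∂μ = μ S := fun t => by
    rw [lintegral_add_right_eq_self (S.indicator (1 : E → ENNReal)), lintegral_indicator_one hS]
  calc ENNReal.ofReal (2 * R) * μ S
      = ∫⁻ t in Icc (-R) R, ∫⁻ x, S.indicator (1 : E → ENNReal) (x + t • u) ∂μ := by
        simp only [htr, lintegral_const, Measure.restrict_apply_univ, Real.volume_Icc]
        rw [mul_comm]; congr 2; ring
    _ = ∫⁻ x, (∫⁻ t in Icc (-R) R, S.indicator (1 : E → ENNReal) (x + t • u)) ∂μ :=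
        lintegral_lintegral_swap hmeas.aemeasurable
    _ ≤ ∫⁻ x, (ball m (2 * R)).indicator (fun _ => K) x ∂μ := by
        refine lintegral_mono fun x => ?_
        by_cases hx : x ∈ ball m (2 * R)
        · rw [indicator_of_mem hx]
          refine le_trans ?_ (hK x hx)
          have hmt : MeasurableSet {t : ℝ | x + t • u ∈ S} :=
            hS.preimage (f := fun t : ℝ => x + t • u) (by fun_prop)
          rw [← lintegral_indicator_one hmt]
          exact setLIntegral_le_lintegral _ _
        · rw [indicator_of_notMem hx]
          refine le_of_eq ?_
          refine setLIntegral_eq_zero measurableSet_Icc fun t ht => ?_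
          refine indicator_of_notMem (fun hh => hx ?_) _
          have h1 := hSR hh
          rw [mem_ball_iff_norm] at h1 ⊢
          have h2 : x - m = (x + t • u - m) - t • u := by abel
          have h3 : ‖t • u‖ ≤ R := by
            rw [norm_smul, hu, mul_one, Real.norm_eq_abs]; exact abs_le.2 ht
          rw [h2]
          have := norm_sub_le (x + t • u - m) (t • u)
          linarith
    _ = K * μ (ball m (2 * R)) := by rw [lintegral_indicator_const measurableSet_ball]

/-- Fubini over lines parallel to the longest segment: doubling the radius costs `2 ^ finrank`, and
the bound on `ε` makes `200 * ε ^ 2 * L * 2 ^ finrank ≤ ε * L`. -/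
theorem CyclicallyMonotone.measure_inter_le {ι : Type*} {p q : ι → E}
    (h : CyclicallyMonotone p q) (e : ι) (hL : p e ≠ q e)
    {ε : ℝ} (hε : 0 < ε) (hε' : ε ≤ 1 / (200 * 2 ^ Module.finrank ℝ E)) (s : Finset ι)
    (hes : e ∉ s) (hsL : ∀ i ∈ s, ‖p i - q i‖ ≤ ‖p e - q e‖) :
    2 * μ (ball (midpoint ℝ (p e) (q e)) (ε * ‖p e - q e‖) ∩
      ⋃ i ∈ s, ball (midpoint ℝ (p i) (q i)) (ε * ‖p i - q i‖)) ≤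
      μ (ball (midpoint ℝ (p e) (q e)) (ε * ‖p e - q e‖)) := by
  set L := ‖p e - q e‖ with hLdef
  have hL0 : 0 < L := norm_pos_iff.2 (sub_ne_zero.2 hL)
  have h2d : (1 : ℝ) ≤ 2 ^ Module.finrank ℝ E := one_le_pow₀ (by norm_num)
  have hε80 : ε ≤ 1 / 80 := hε'.trans
    (one_div_le_one_div_of_le (by norm_num) (by linarith))
  set S := ball (midpoint ℝ (p e) (q e)) (ε * L) ∩
      ⋃ i ∈ s, ball (midpoint ℝ (p i) (q i)) (ε * ‖p i - q i‖) with hSdef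
  have hS : MeasurableSet S := measurableSet_ball.inter
    (s.measurableSet_biUnion fun _ _ => measurableSet_ball)
  have hu : ‖L⁻¹ • (p e - q e)‖ = 1 := by
    rw [norm_smul, norm_inv, Real.norm_eq_abs, abs_of_pos hL0, ← hLdef, inv_mul_cancel₀ hL0.ne']
  have hue : p e - q e = L • (L⁻¹ • (p e - q e)) := by
    rw [smul_smul, mul_inv_cancel₀ hL0.ne', one_smul]
  have key := two_mul_measure_le_of_line μ hS hu (inter_subset_left)
    (fun x hx => h.volume_line_le e hL0 rfl hε hε80 s hes hsL hu hue hx)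
  have hball : μ (ball (midpoint ℝ (p e) (q e)) (2 * (ε * L))) =
      ENNReal.ofReal (2 ^ Module.finrank ℝ E) * μ (ball (midpoint ℝ (p e) (q e)) (ε * L)) := by
    rw [Measure.addHaar_ball_mul_of_pos μ _ (by norm_num : (0 : ℝ) < 2),
      Measure.addHaar_ball_center μ (midpoint ℝ (p e) (q e))]
  rw [hball, ← mul_assoc (ENNReal.ofReal (200 * ε ^ 2 * L)), ← ENNReal.ofReal_mul (by positivity)] at key
  have hle : ENNReal.ofReal (200 * ε ^ 2 * L * 2 ^ Module.finrank ℝ E) ≤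
      ENNReal.ofReal (ε * L) := by
    apply ENNReal.ofReal_le_ofReal
    rw [le_div_iff₀ (by positivity)] at hε'
    nlinarith [mul_pos hε hL0]
  have key2 : ENNReal.ofReal (ε * L) * (2 * μ S) ≤
      ENNReal.ofReal (ε * L) * μ (ball (midpoint ℝ (p e) (q e)) (ε * L)) := by
    refine le_trans (le_of_eq ?_) (key.trans (mul_le_mul_left hle _))
    rw [ENNReal.ofReal_mul (by norm_num : (0 : ℝ) ≤ 2), ENNReal.ofReal_ofNat]; ring
  exact (ENNReal.mul_le_mul_iff_right (by simpa using mul_pos hε hL0)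
    ENNReal.ofReal_ne_top).1 key2

/-- Adding segments by increasing length, each new ball contributes at least half of its volume to
the union. -/
theorem CyclicallyMonotone.sum_measure_le {ι : Type*} {p q : ι → E}
    (h : CyclicallyMonotone p q) (hL : ∀ i, p i ≠ q i)
    {ε : ℝ} (hε : 0 < ε) (hε' : ε ≤ 1 / (200 * 2 ^ Module.finrank ℝ E)) (s : Finset ι) :
    ∑ i ∈ s, μ (ball (midpoint ℝ (p i) (q i)) (ε * ‖p i - q i‖)) ≤
      2 * μ (⋃ i ∈ s, ball (midpoint ℝ (p i) (q i)) (ε * ‖p i - q i‖)) := by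
  classical
  induction s using Finset.induction_on_max_value (fun i => ‖p i - q i‖) with
  | empty => simp
  | insert a s has hmax ih =>
    set B : ι → Set E := fun i => ball (midpoint ℝ (p i) (q i)) (ε * ‖p i - q i‖) with hB
    have h1 : 2 * μ (B a ∩ ⋃ i ∈ s, B i) ≤ μ (B a) :=
      h.measure_inter_le μ a (hL a) hε hε' s has hmax
    have hmU : MeasurableSet (⋃ i ∈ s, B i) :=
      s.measurableSet_biUnion fun _ _ => measurableSet_ball
    have h2 := measure_inter_add_sdiff (μ := μ) (B a) hmU
    have h3 : μ (⋃ i ∈ insert a s, B i) = μ (⋃ i ∈ s, B i) + μ (B a \ ⋃ i ∈ s, B i) := by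
      rw [Finset.set_biUnion_insert, union_comm, ← union_sdiff_self,
        measure_union' disjoint_sdiff_right hmU]
    have hfin : μ (B a ∩ ⋃ i ∈ s, B i) ≠ ⊤ :=
      ((measure_mono inter_subset_left).trans_lt measure_ball_lt_top).ne
    have h4 : μ (B a) ≤ 2 * μ (B a \ ⋃ i ∈ s, B i) := by
      rw [← h2, two_mul] at h1
      have h5 := ENNReal.le_of_add_le_add_left hfin h1
      rw [← h2, two_mul]
      gcongr
    rw [Finset.sum_insert has, h3, mul_add, add_comm]
    exact add_le_add ih h4

end Volume

/-! ### Truncation to the cube and the final bound -/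

section Cube
open MeasureTheory Metric Set
variable {d : ℕ}

theorem IsCube.isClosed {s : ℝ} {C : Set (Pt d)} (h : IsCube s C) : IsClosed C := by
  obtain ⟨φ, rfl⟩ := h
  refine φ.toHomeomorph.isClosedMap _ ?_
  simp only [ofPred_forall]
  exact isClosed_iInter fun i => isClosed_Icc.preimage (by fun_prop)

theorem IsCube.exists_subset_closedBall {s : ℝ} (hs : 0 ≤ s) {C : Set (Pt d)} (h : IsCube s C) :
    ∃ z, C ⊆ closedBall z (√d * s) := by
  obtain ⟨φ, rfl⟩ := h
  refine ⟨φ 0, ?_⟩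
  rintro _ ⟨x, hx, rfl⟩
  rw [mem_closedBall, φ.dist_eq, dist_zero_right, EuclideanSpace.norm_eq]
  apply Real.sqrt_le_iff.2 ⟨by positivity, ?_⟩
  rw [mul_pow, Real.sq_sqrt (by positivity)]
  calc ∑ i, ‖x i‖ ^ 2 ≤ ∑ _i : Fin d, s ^ 2 := Finset.sum_le_sum fun i _ => by
        rw [Real.norm_eq_abs, sq_abs]
        exact pow_le_pow_left₀ (hx i).1 (hx i).2 2
    _ = d * s ^ 2 := by simp

/-- The two near points of a segment split it into three pieces. -/
theorem IsNearPoint.norm_sub_eq_add {O : Set (Pt d)} {p q b c : Pt d} (hb : IsNearPoint O p q b)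
    (hc : IsNearPoint O q p c) : ‖p - q‖ = ‖p - b‖ + ‖b - c‖ + ‖c - q‖ := by
  have hb1 := hb.1.1
  have hc1 := hc.1.1
  have hle := hb.2 c ⟨by rw [segment_symm]; exact hc1, hc.1.2⟩
  rw [segment_symm] at hc1
  rw [segment_eq_image' ℝ p q] at hb1 hc1
  obtain ⟨s, hs, rfl⟩ := hb1
  obtain ⟨t, ht, rfl⟩ := hc1
  rcases eq_or_ne p q with rfl | hne
  · simp
  have hpos : 0 < ‖q - p‖ := norm_pos_iff.2 (sub_ne_zero.2 hne.symm)
  simp only [sub_add_cancel_left, norm_neg, norm_smul, Real.norm_eq_abs, abs_of_nonneg hs.1,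
    abs_of_nonneg ht.1] at hle
  have hst : s ≤ t := le_of_mul_le_mul_right hle hpos
  have h1 : p - (p + s • (q - p)) = (-s) • (q - p) := by module
  have h2 : p + s • (q - p) - (p + t • (q - p)) = -((t - s) • (q - p)) := by module
  have h3 : p + t • (q - p) - q = -((1 - t) • (q - p)) := by module
  simp only [h1, h2, h3, norm_neg, norm_smul, Real.norm_eq_abs, abs_of_nonneg hs.1,
    abs_of_nonneg (sub_nonneg.2 hst), abs_of_nonneg (sub_nonneg.2 ht.2), norm_sub_rev p q]
  ring

/-- A family of segments in a ball that is cyclically monotone has `d`-th powers of the lengths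
summing up to at most a multiple of the volume of the ball. -/
theorem CyclicallyMonotone.sum_pow_le {ι : Type*} {p q : ι → Pt d} (h : CyclicallyMonotone p q)
    (hL : ∀ i, p i ≠ q i) (s : Finset ι) {z : Pt d} {r : ℝ} (hr : 0 < r)
    (hp : ∀ i ∈ s, p i ∈ closedBall z r) (hq : ∀ i ∈ s, q i ∈ closedBall z r) :
    ∑ i ∈ s, ‖p i - q i‖ ^ d ≤ 2 * (3 * (200 * 2 ^ d) * r) ^ d := by
  have hfr : Module.finrank ℝ (Pt d) = d := by simp
  set ε : ℝ := 1 / (200 * 2 ^ d) with hεdef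
  have hε : 0 < ε := by positivity
  have hε1 : ε ≤ 1 := by
    rw [hεdef, div_le_one (by positivity)]
    have : (1 : ℝ) ≤ 2 ^ d := one_le_pow₀ (by norm_num)
    linarith
  have hpos : ∀ i, 0 < ‖p i - q i‖ := fun i => norm_pos_iff.2 (sub_ne_zero.2 (hL i))
  have key := h.sum_measure_le volume hL hε (by rw [hfr]) s
  have hsub : (⋃ i ∈ s, ball (midpoint ℝ (p i) (q i)) (ε * ‖p i - q i‖)) ⊆ ball z (3 * r) := by
    refine iUnion₂_subset fun i hi => ball_subset_ball' ?_ |>.trans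
      (ball_subset_ball (ε₁ := ε * ‖p i - q i‖ + dist (midpoint ℝ (p i) (q i)) z) ?_)
    · exact le_rfl
    · have h1 : midpoint ℝ (p i) (q i) ∈ closedBall z r :=
        (convex_closedBall z r).midpoint_mem (hp i hi) (hq i hi)
      have h2 : dist (p i) (q i) ≤ 2 * r := by
        have := dist_triangle_right (p i) (q i) z
        have := mem_closedBall.1 (hp i hi)
        have := mem_closedBall.1 (hq i hi)
        linarith
      rw [dist_eq_norm] at h2
      have := mem_closedBall.1 h1
      nlinarith [hpos i]
  have hball : ∀ (x : Pt d) {a : ℝ}, 0 < a →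
      volume (ball x a) = ENNReal.ofReal (a ^ d) * volume (ball (0 : Pt d) 1) := fun x a ha => by
    rw [Measure.addHaar_ball_of_pos volume x ha, hfr]
  have hdbl : (2 : ENNReal) * ENNReal.ofReal ((3 * r) ^ d) = ENNReal.ofReal (2 * (3 * r) ^ d) := by
    rw [ENNReal.ofReal_mul (by norm_num), ENNReal.ofReal_ofNat]
  have key2 := key.trans (mul_le_mul_right (measure_mono hsub) 2)
  rw [hball z (by positivity), ← mul_assoc,
    Finset.sum_congr rfl fun i _ => hball _ (mul_pos hε (hpos i)), ← Finset.sum_mul,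
    ENNReal.mul_le_mul_iff_left (measure_ball_pos _ _ one_pos).ne' measure_ball_lt_top.ne,
    ← ENNReal.ofReal_sum_of_nonneg fun i _ => by positivity, hdbl,
    ENNReal.ofReal_le_ofReal_iff (by positivity)] at key2
  simp only [mul_pow ε, ← Finset.mul_sum] at key2
  have h3 : (3 * (200 * 2 ^ d) * r) ^ d = (3 * r) ^ d / ε ^ d := by
    rw [← div_pow, hεdef]; congr 1; field_simp
  rw [h3, ← mul_div_assoc, le_div_iff₀ (by positivity)]
  linarith

open Classical in
theorem edgeContribution_mk_le (w : ℝ) (C : Set (Pt d)) (p q : Pt d) :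
    edgeContribution w C s(p, q) ≤
      if (segment ℝ p q ∩ C).Nonempty then ‖nearPoint C p q - nearPoint C q p‖ ^ d else 0 := by
  simp only [edgeContribution, Sym2.lift_mk]
  split_ifs
  · exact min_le_right _ _
  · exact le_rfl

theorem IsMinCostMatching.rho_le (hd : d ≠ 0) {P : Finset (Pt d)} {M : Finset (Sym2 (Pt d))}
    (h : IsMinCostMatching P M) {w w' : ℝ} (hw : 0 < w) {C : Set (Pt d)} (hC : IsCube w C) :
    rho w' C M ≤ 2 * (3 * (200 * 2 ^ d) * (√d * w)) ^ d := by
  classical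
  have hrep : ∀ e : Sym2 (Pt d), ∃ x y, s(x, y) = e := fun e => by
    induction e with | h x y => exact ⟨x, y, rfl⟩
  choose A B hAB using hrep
  let p' : Sym2 (Pt d) → Pt d := fun e => nearPoint C (A e) (B e)
  let q' : Sym2 (Pt d) → Pt d := fun e => nearPoint C (B e) (A e)
  -- Edges meeting the cube in a single point are dropped; they contribute `0 ^ d = 0` because `d ≠
  -- 0`.
  let N := M.filter fun e => (segment ℝ (A e) (B e) ∩ C).Nonempty ∧ p' e ≠ q' e
  have hrho : rho w' C M ≤ ∑ e ∈ N, ‖p' e - q' e‖ ^ d := by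
    rw [rho, Finset.sum_filter]
    refine Finset.sum_le_sum fun e _ => ?_
    have h1 := edgeContribution_mk_le w' C (A e) (B e)
    rw [hAB] at h1
    refine h1.trans (le_of_eq ?_)
    by_cases h2 : (segment ℝ (A e) (B e) ∩ C).Nonempty
    · by_cases h3 : p' e = q' e
      · have h4 : ‖nearPoint C (A e) (B e) - nearPoint C (B e) (A e)‖ = 0 := by
          rw [norm_eq_zero, sub_eq_zero]; exact h3
        simp [h3, h4, hd]
      · simp only [h2, h3, if_true, ne_eq, not_false_eq_true, and_self]; rfl
    · simp [h2]
  have hnear : ∀ e : N, IsNearPoint C (A e) (B e) (p' e) ∧ IsNearPoint C (B e) (A e) (q' e) := by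
    intro e
    have hne := (Finset.mem_filter.1 e.2).2.1
    obtain ⟨b, hb⟩ := IsNearPoint.exists_of_isClosed hC.isClosed hne
    obtain ⟨c, hc⟩ := IsNearPoint.exists_of_isClosed hC.isClosed (segment_symm ℝ (A e) (B e) ▸ hne)
    simp only [p', q', nearPoint_eq hb, nearPoint_eq hc]
    exact ⟨hb, hc⟩
  have hcm : CyclicallyMonotone (fun e : N => A e) (fun e : N => B e) :=
    h.cyclicallyMonotone (fun e => by rw [hAB]; exact (Finset.mem_filter.1 e.2).1)
      (fun e f hef => Subtype.ext (by simpa only [hAB] using hef))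
  have hcm' : CyclicallyMonotone (fun e : N => p' e) (fun e : N => q' e) :=
    hcm.truncate fun e => (hnear e).1.norm_sub_eq_add (hnear e).2
  obtain ⟨z, hz⟩ := hC.exists_subset_closedBall hw.le
  have hd' : (0 : ℝ) < d := by exact_mod_cast Nat.pos_of_ne_zero hd
  have hmain := hcm'.sum_pow_le (fun e => (Finset.mem_filter.1 e.2).2.2) Finset.univ
    (z := z) (r := √d * w) (by positivity) (fun e _ => hz (hnear e).1.1.2)
    (fun e _ => hz (hnear e).2.1.2)
  rw [Finset.sum_coe_sort N fun e => ‖p' e - q' e‖ ^ d] at hmain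
  exact hrho.trans hmain

end Cube

end MinCostMatching

theorem lemma5p1 (d : ℕ) :
    ∃ c : ℝ, 0 < c ∧
      ∀ (l w : ℝ), 0 < l → 0 < w →
      ∀ (Cl Cw : Set (MinCostMatching.Pt d)),
        MinCostMatching.IsCube l Cl → MinCostMatching.IsCube w Cw → Cw ⊆ Cl →
      ∀ (P : Finset (MinCostMatching.Pt d)) (M : Finset (Sym2 (MinCostMatching.Pt d))),
        (P : Set (MinCostMatching.Pt d)) ⊆ Cl →
        MinCostMatching.IsMinCostMatching P M →
        MinCostMatching.rho w Cw M ≤ c * w ^ d := by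
  rcases eq_or_ne d 0 with rfl | hd
  · refine ⟨1, one_pos, fun l w _ hw Cl Cw _ _ _ P M _ hM => ?_⟩
    -- In dimension zero there are no two distinct points to pair.
    have hempty : M = ∅ := by
      refine Finset.eq_empty_of_forall_notMem fun e he => (hM.1.1 e he).1 ?_
      induction e with | h x y => exact Subsingleton.elim x y
    simp [hempty, MinCostMatching.rho]
  · have hd' : (0 : ℝ) < d := by exact_mod_cast Nat.pos_of_ne_zero hd
    refine ⟨2 * (3 * (200 * 2 ^ d) * √d) ^ d, by positivity,
      fun l w _ hw Cl Cw _ hCw _ P M _ hM => ?_⟩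
    rw [mul_assoc, ← mul_pow, mul_assoc (3 * (200 * 2 ^ d))]
    exact hM.rho_le hd hw hCw
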